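/- For every $\delta>0$ there is a constant $C=C(\delta)>0$ such that the following holds for every $N\ge 0$, every real polynomial $p$ in $N$ variables of degree at most $2$ with $|p(x)|\le 1$ for all $x\in\{-1,1\}^N$, and every $\varepsilon>0$. There is a nonadaptive classical randomized query algorithm (a probability distribution, independent of the input, over pairs consisting of a set $Q\subseteq\{1,\dots,N\}$ and a function $g:\{-1,1\}^{Q}\to\mathbb{R}$; on input $x$ it draws $(Q,g)$, queries $x_i$ for all $i\in Q$, and outputs $\tilde p=g(x|_Q)$) that always makes at most $C\sqrt{N}/\varepsilon=C\,(N/\varepsilon^2)^{1/2}$ queries and that satisfies, for every $x\in\{-1,1\}^N$, $$\Pr\bigl[\,|\tilde p-p(x)|\le\varepsilon\,\bigr]\ge 1-\delta .$$ In particular, every degree-$2$ real polynomial bounded in $[-1,1]$ on $\{-1,1\}^N$ can be estimated to any constant additive error, with any constant success probability below $1$, by $O(\sqrt N)$ nonadaptive randomized queries. -/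

import Mathlib

/-- The Boolean cube `{-1, 1}^N`; the group of units `ℤˣ` consists exactly of `1` and `-1`. -/
abbrev SignCube (N : ℕ) : Type := Fin N → ℤˣ

/-- The value of a real polynomial in `N` variables at a point of the Boolean cube. -/
noncomputable def cubeEval {N : ℕ} (p : MvPolynomial (Fin N) ℝ) (x : SignCube N) : ℝ :=
  MvPolynomial.eval (fun i => (((x i : ℤˣ) : ℤ) : ℝ)) p

/-- A deterministic nonadaptive query algorithm on `{-1, 1}^N` with real output: the set of
coordinates it queries is fixed in advance, and its output is a function of the answers to these
queries and of nothing else. -/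
structure NonadaptiveQueryAlg (N : ℕ) where
  /-- the queried coordinates -/
  queries : Finset (Fin N)
  /-- the output, given the values of the queried coordinates -/
  decode : ({i // i ∈ queries} → ℤˣ) → ℝ

/-- The output of a deterministic nonadaptive query algorithm on the input `x`. -/
def NonadaptiveQueryAlg.output {N : ℕ} (A : NonadaptiveQueryAlg N) (x : SignCube N) : ℝ :=
  A.decode (fun i => x i.1)

/-- A randomized nonadaptive query algorithm: a (discrete) probability distribution over
deterministic ones, chosen independently of the input. -/
abbrev RandomizedQueryAlg (N : ℕ) : Type := PMF (NonadaptiveQueryAlg N)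

/-- The algorithm makes at most `q` queries, whatever its random choices (and its input) are. -/
def RandomizedQueryAlg.MakesAtMost {N : ℕ} (R : RandomizedQueryAlg N) (q : ℝ) : Prop :=
  ∀ A ∈ R.support, (A.queries.card : ℝ) ≤ q

/-- On every input `x`, the output of the algorithm is within `ε` of `f x` with probability at
least `1 - δ` over the random choices of the algorithm. -/
def RandomizedQueryAlg.Estimates {N : ℕ} (R : RandomizedQueryAlg N) (f : SignCube N → ℝ)
    (ε δ : ℝ) : Prop :=
  ∀ x : SignCube N,
    ENNReal.ofReal (1 - δ) ≤
      PMF.toOuterMeasure R {A : NonadaptiveQueryAlg N | |A.output x - f x| ≤ ε}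

/-! On the cube, `p` equals `c + b·x + xᵀAx` with `A` symmetric and without diagonal. Comparing `x`
with `-x` gives `∑ |b i| ≤ 1`; multilinearity and polarization give `xᵀAy ≤ 2` for all signs `x`,
`y` (`bilin_le_two`).

The algorithm draws two independent sequences of `m` coordinates from a distribution `v` and
averages an importance-weighted estimate over all `m²` pairs. The variance is at most the second
moment of a single pair divided by `m²`, plus the second moments of the row and column averages
divided by `m` (`sampleAvg_gridMean_sub_sq_le`). If the first is `O(N)` and the other two are
`O(1)`, then `m` of order `√N / ε` suffices, by Chebyshev.

The crux is a `v` with `∑ i, (Ax)_i² / v i = O(1)` for all `x` at once. For a distribution `w` on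
the cube, Grothendieck's inequality bounds `∑ i, √(E_w (Ax)_i²)`. At a maximizer `w` of a
regularized version of this concave function, the first-order condition towards the point mass at
`x` is the desired bound (`exists_weights_of_bilin_le`). Averaging it over `x` bounds `∑ A i j² / v
i`, and mixing `v` with the uniform distribution gives `1 / v j = O(N)`, hence the `O(N)` for a
single pair. -/

/-- The `i`-th coordinate of a point of the Boolean cube, as a real number. -/
def signVal {N : ℕ} (x : SignCube N) (i : Fin N) : ℝ := ((x i : ℤ) : ℝ)

lemma signVal_eq_one_or {N : ℕ} (x : SignCube N) (i : Fin N) :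
    signVal x i = 1 ∨ signVal x i = -1 := by
  unfold signVal
  rcases Int.units_eq_one_or (x i) with h | h <;> simp [h]

lemma signVal_sq {N : ℕ} (x : SignCube N) (i : Fin N) : signVal x i ^ 2 = 1 := by
  rcases signVal_eq_one_or x i with h | h <;> simp [h]

lemma signVal_mul_self {N : ℕ} (x : SignCube N) (i : Fin N) : signVal x i * signVal x i = 1 := by
  rw [← sq, signVal_sq]

@[simp] lemma signVal_neg {N : ℕ} (x : SignCube N) (i : Fin N) :
    signVal (-x) i = -signVal x i := by
  simp [signVal]

/-- The point of the cube whose signs are those of a real vector. -/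
noncomputable def signVec {N : ℕ} (a : Fin N → ℝ) : SignCube N :=
  fun i => if 0 ≤ a i then 1 else -1

lemma mul_signVal_signVec {N : ℕ} (a : Fin N → ℝ) (i : Fin N) :
    a i * signVal (signVec a) i = |a i| := by
  unfold signVal signVec
  split_ifs with h
  · simp [abs_of_nonneg h]
  · simp [abs_of_neg (not_le.1 h)]

lemma sum_abs_le_of_forall_sign {N : ℕ} {a : Fin N → ℝ} {M : ℝ}
    (h : ∀ x : SignCube N, ∑ i, a i * signVal x i ≤ M) : ∑ i, |a i| ≤ M := by
  refine le_trans (le_of_eq ?_) (h (signVec a))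
  simp only [mul_signVal_signVec]

/-! ### Averages over the cube and moments of Rademacher sums. -/

/-- The average of a function over the Boolean cube. -/
noncomputable def cubeAvg {n : ℕ} (f : SignCube n → ℝ) : ℝ := (∑ x, f x) / 2 ^ n

lemma cubeAvg_mono {n : ℕ} {f g : SignCube n → ℝ} (h : ∀ x, f x ≤ g x) :
    cubeAvg f ≤ cubeAvg g := by
  unfold cubeAvg
  gcongr
  exact h _

lemma cubeAvg_add {n : ℕ} (f g : SignCube n → ℝ) :
    cubeAvg (fun x => f x + g x) = cubeAvg f + cubeAvg g := by
  simp only [cubeAvg, Finset.sum_add_distrib, add_div]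

lemma cubeAvg_const_mul {n : ℕ} (a : ℝ) (f : SignCube n → ℝ) :
    cubeAvg (fun x => a * f x) = a * cubeAvg f := by
  simp only [cubeAvg, ← Finset.mul_sum, mul_div_assoc]

lemma cubeAvg_sum {n : ℕ} {ι : Type*} (s : Finset ι) (f : ι → SignCube n → ℝ) :
    cubeAvg (fun x => ∑ i ∈ s, f i x) = ∑ i ∈ s, cubeAvg (f i) := by
  simp only [cubeAvg, Finset.sum_div]
  exact Finset.sum_comm

lemma cubeAvg_const {n : ℕ} (a : ℝ) : cubeAvg (fun _ : SignCube n => a) = a := by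
  have : (2 : ℝ) ^ n ≠ 0 := by positivity
  simp [cubeAvg, Finset.sum_const, Finset.card_univ]

lemma cubeAvg_succ {n : ℕ} (f : SignCube (n + 1) → ℝ) :
    cubeAvg f = (cubeAvg (fun x : SignCube n => f (Fin.cons (1 : ℤˣ) x)) +
      cubeAvg (fun x : SignCube n => f (Fin.cons (-1 : ℤˣ) x))) / 2 := by
  have h : ∑ x, f x = ∑ e : ℤˣ, ∑ x : SignCube n, f (Fin.cons e x) := by
    rw [← Fintype.sum_prod_type']
    exact (Fintype.sum_equiv (Fin.consEquiv fun _ => ℤˣ) _ _ fun _ => rfl).symm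
  have h2 : (Finset.univ : Finset ℤˣ) = {1, -1} := rfl
  rw [cubeAvg, h, h2, Finset.sum_pair (by decide), cubeAvg, cubeAvg, pow_succ]
  field_simp

/-- The Rademacher sum with coefficients `u`. -/
noncomputable def radSum {n : ℕ} (u : Fin n → ℝ) (x : SignCube n) : ℝ := ∑ i, u i * signVal x i

lemma radSum_cons {n : ℕ} (u : Fin (n + 1) → ℝ) (e : ℤˣ) (x : SignCube n) :
    radSum u (Fin.cons e x) = u 0 * ((e : ℤ) : ℝ) + radSum (fun i => u i.succ) x := by
  simp [radSum, Fin.sum_univ_succ, signVal]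

lemma cubeAvg_radSum {n : ℕ} (u : Fin n → ℝ) : cubeAvg (radSum u) = 0 := by
  induction n with
  | zero => simp [cubeAvg, radSum]
  | succ n ih =>
    rw [cubeAvg_succ]
    simp only [radSum_cons, cubeAvg_add, cubeAvg_const, ih]
    simp

lemma cubeAvg_radSum_mul {n : ℕ} (u v : Fin n → ℝ) :
    cubeAvg (fun x => radSum u x * radSum v x) = ∑ i, u i * v i := by
  induction n with
  | zero => simp [cubeAvg, radSum]
  | succ n ih =>
    rw [cubeAvg_succ, Fin.sum_univ_succ, ← ih]
    have h (e : ℤˣ) : cubeAvg (fun x : SignCube n => radSum u (Fin.cons e x) *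
          radSum v (Fin.cons e x)) = u 0 * v 0 +
        cubeAvg (fun x => radSum (fun i => u i.succ) x * radSum (fun i => v i.succ) x) := by
      have h1 : (((e : ℤ) : ℝ)) * ((e : ℤ) : ℝ) = 1 := by
        rcases Int.units_eq_one_or e with h | h <;> simp [h]
      have h2 : ∀ x : SignCube n, radSum u (Fin.cons e x) * radSum v (Fin.cons e x) =
          u 0 * v 0 + ((u 0 * e * radSum (fun i => v i.succ) x +
            v 0 * e * radSum (fun i => u i.succ) x) +
            radSum (fun i => u i.succ) x * radSum (fun i => v i.succ) x) := by
        intro x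
        rw [radSum_cons, radSum_cons]
        linear_combination (u 0 * v 0) * h1
      simp only [h2, cubeAvg_add, cubeAvg_const, cubeAvg_const_mul, cubeAvg_radSum]
      ring
    rw [h, h]
    ring

/-- Averaging over the first sign kills the odd powers. What remains, `a⁴ + 6a²σ²` plus the fourth
moment of the tail, is at most `3(a² + σ²)²` by induction. -/
lemma cubeAvg_radSum_pow_four_le {n : ℕ} (u : Fin n → ℝ) :
    cubeAvg (fun x => radSum u x ^ 4) ≤ 3 * (∑ i, u i ^ 2) ^ 2 := by
  induction n with
  | zero => simp [cubeAvg, radSum]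
  | succ n ih =>
    rw [cubeAvg_succ, Fin.sum_univ_succ]
    set u' : Fin n → ℝ := fun i => u i.succ with hu'
    have h2 := cubeAvg_radSum_mul u' u'
    have h4 := ih u'
    have key : (cubeAvg (fun x : SignCube n => radSum u (Fin.cons (1 : ℤˣ) x) ^ 4) +
        cubeAvg (fun x : SignCube n => radSum u (Fin.cons (-1 : ℤˣ) x) ^ 4)) / 2 =
        u 0 ^ 4 + 6 * u 0 ^ 2 * ∑ i, u' i ^ 2 + cubeAvg (fun x => radSum u' x ^ 4) := by
      rw [← cubeAvg_add]
      have h : ∀ x : SignCube n, radSum u (Fin.cons (1 : ℤˣ) x) ^ 4 +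
          radSum u (Fin.cons (-1 : ℤˣ) x) ^ 4 = 2 * u 0 ^ 4 +
          (12 * u 0 ^ 2 * (radSum u' x * radSum u' x) + 2 * radSum u' x ^ 4) := by
        intro x
        rw [radSum_cons, radSum_cons]
        simp only [Units.val_one, Units.val_neg, Int.cast_one, Int.cast_neg]
        ring
      simp only [h, cubeAvg_add, cubeAvg_const, cubeAvg_const_mul, h2, sq]
      ring
    rw [key]
    have h0 : 0 ≤ u 0 ^ 4 := by positivity
    nlinarith

/-- A bilinear form bounded on signs is bounded on vectors with entries in `[-1, 1]`. -/
lemma bilin_le_of_sign {m n : ℕ} {A : Fin m → Fin n → ℝ} {M : ℝ}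
    (hA : ∀ (x : SignCube m) (y : SignCube n),
      ∑ i, ∑ j, A i j * signVal x i * signVal y j ≤ M)
    {s : Fin m → ℝ} {t : Fin n → ℝ} (hs : ∀ i, |s i| ≤ 1) (ht : ∀ j, |t j| ≤ 1) :
    ∑ i, ∑ j, A i j * s i * t j ≤ M := by
  have lin : ∀ {k : ℕ} {a r : Fin k → ℝ}, (∀ i, |r i| ≤ 1) → ∑ i, a i * r i ≤ ∑ i, |a i| := by
    intro k a r hr
    refine Finset.sum_le_sum fun i _ => (le_abs_self _).trans ?_
    rw [abs_mul]
    exact mul_le_of_le_one_right (abs_nonneg _) (hr i)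
  have h1 : ∀ y : SignCube n, ∑ j, (∑ i, A i j * s i) * signVal y j ≤ M := by
    intro y
    calc ∑ j, (∑ i, A i j * s i) * signVal y j
        = ∑ i, (∑ j, A i j * signVal y j) * s i := by
          simp only [Finset.sum_mul]
          rw [Finset.sum_comm]
          exact Finset.sum_congr rfl fun i _ => Finset.sum_congr rfl fun j _ => by ring
      _ ≤ ∑ i, |∑ j, A i j * signVal y j| := lin hs
      _ ≤ M := by
          refine sum_abs_le_of_forall_sign fun x => le_trans (le_of_eq ?_) (hA x y)
          simp only [Finset.sum_mul]
          exact Finset.sum_congr rfl fun i _ => Finset.sum_congr rfl fun j _ => by ring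
  calc ∑ i, ∑ j, A i j * s i * t j = ∑ j, (∑ i, A i j * s i) * t j := by
        simp only [Finset.sum_mul]
        exact Finset.sum_comm
    _ ≤ ∑ j, |∑ i, A i j * s i| := lin ht
    _ ≤ M := sum_abs_le_of_forall_sign h1

/-! ### Grothendieck's inequality by truncation of Rademacher sums. -/

/-- Clipping a real number to the interval `[-L, L]`. -/
noncomputable def clip (L t : ℝ) : ℝ := max (-L) (min t L)

lemma abs_clip_le {L : ℝ} (hL : 0 ≤ L) (t : ℝ) : |clip L t| ≤ L := by
  unfold clip
  rw [abs_le]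
  exact ⟨le_max_left _ _, max_le (by linarith) (min_le_right _ _)⟩

lemma clip_sq_le {L : ℝ} (hL : 0 ≤ L) (t : ℝ) : clip L t ^ 2 ≤ t ^ 2 := by
  unfold clip
  rcases le_total t L with h | h <;> simp only [h, min_eq_left, min_eq_right]
  · rcases le_total t (-L) with h' | h' <;> simp only [h', max_eq_left, max_eq_right, le_refl]
    nlinarith
  · rw [max_eq_right (by linarith)]
    nlinarith

/-- Beyond the threshold, `4L(r - L) ≤ r²` because `(r - 2L)² ≥ 0`; squaring gives the bound. -/
lemma sub_clip_sq_le {L : ℝ} (hL : 0 < L) (t : ℝ) :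
    (t - clip L t) ^ 2 ≤ t ^ 4 / (16 * L ^ 2) := by
  have aux : ∀ r : ℝ, L ≤ r → (r - L) ^ 2 ≤ r ^ 4 / (16 * L ^ 2) := by
    intro r hr
    rw [le_div_iff₀ (by positivity)]
    have h1 : 0 ≤ 4 * L * (r - L) := by nlinarith
    have h2 : 4 * L * (r - L) ≤ r ^ 2 := by nlinarith [sq_nonneg (r - 2 * L)]
    nlinarith [pow_le_pow_left₀ h1 h2 2]
  unfold clip
  rcases le_total t L with h | h <;> simp only [h, min_eq_left, min_eq_right]
  · rcases le_total t (-L) with h' | h' <;> simp only [h', max_eq_left, max_eq_right]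
    · have := aux (-t) (by linarith)
      calc (t - -L) ^ 2 = (-t - L) ^ 2 := by ring
        _ ≤ _ := this
        _ = _ := by ring
    · rw [sub_self, zero_pow two_ne_zero]
      positivity
  · rw [max_eq_right (by linarith)]
    exact aux t h

/-- The values of a bilinear form on unit vectors of real Hilbert spaces of finite dimension. -/
def hilbertValues {m n : ℕ} (A : Fin m → Fin n → ℝ) : Set ℝ :=
  {r | ∃ (d : ℕ) (u : Fin m → Fin d → ℝ) (v : Fin n → Fin d → ℝ),
    (∀ i, ∑ k, u i k ^ 2 ≤ 1) ∧ (∀ j, ∑ k, v j k ^ 2 ≤ 1) ∧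
      r = ∑ i, ∑ j, A i j * ∑ k, u i k * v j k}

/-- Finiteness of the supremum `K` is what allows `K / 2` to be absorbed in Grothendieck's
inequality. -/
lemma bddAbove_hilbertValues {m n : ℕ} (A : Fin m → Fin n → ℝ) :
    BddAbove (hilbertValues A) := by
  refine ⟨∑ i, ∑ j, |A i j|, ?_⟩
  rintro r ⟨d, u, v, hu, hv, rfl⟩
  refine Finset.sum_le_sum fun i _ => Finset.sum_le_sum fun j _ => (le_abs_self _).trans ?_
  rw [abs_mul]
  refine mul_le_of_le_one_right (abs_nonneg _) (abs_le_one_iff_mul_self_le_one.2 ?_)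
  have h := Finset.sum_mul_sq_le_sq_mul_sq Finset.univ (u i) (v j)
  have h0 : 0 ≤ ∑ k, v j k ^ 2 := Finset.sum_nonneg fun _ _ => sq_nonneg _
  rw [← sq]
  exact h.trans (mul_le_one₀ (hu i) h0 (hv j))

lemma sum_le_sSup_hilbertValues {m n : ℕ} (A : Fin m → Fin n → ℝ) {D : Type*} [Fintype D]
    {α β : ℝ} (hα : 0 < α) (hβ : 0 < β) (f : Fin m → D → ℝ) (g : Fin n → D → ℝ)
    (hf : ∀ i, ∑ k, f i k ^ 2 ≤ α ^ 2) (hg : ∀ j, ∑ k, g j k ^ 2 ≤ β ^ 2) :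
    ∑ i, ∑ j, A i j * ∑ k, f i k * g j k ≤ α * β * sSup (hilbertValues A) := by
  let e := (Fintype.equivFin D).symm
  have hmem : (∑ i, ∑ j, A i j * ∑ k, f i k * g j k) / (α * β) ∈ hilbertValues A := by
    refine ⟨Fintype.card D, fun i k => f i (e k) / α, fun j k => g j (e k) / β, ?_, ?_, ?_⟩
    · intro i
      rw [e.sum_comp (fun k => (f i k / α) ^ 2)]
      simp only [div_pow, ← Finset.sum_div]
      exact div_le_one_of_le₀ (hf i) (sq_nonneg _)
    · intro j
      rw [e.sum_comp (fun k => (g j k / β) ^ 2)]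
      simp only [div_pow, ← Finset.sum_div]
      exact div_le_one_of_le₀ (hg j) (sq_nonneg _)
    · simp only [Finset.sum_div]
      refine Finset.sum_congr rfl fun i _ => Finset.sum_congr rfl fun j _ => ?_
      rw [e.sum_comp (fun k => f i k / α * (g j k / β)), mul_div_assoc, Finset.sum_div]
      congr 1
      exact Finset.sum_congr rfl fun k _ => by field_simp
  have := le_csSup (bddAbove_hilbertValues A) hmem
  rw [div_le_iff₀ (by positivity)] at this
  linarith

lemma sum_cubeAvg_le_sSup_hilbertValues {m n d : ℕ} (A : Fin m → Fin n → ℝ)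
    {α β : ℝ} (hα : 0 < α) (hβ : 0 < β) (f : Fin m → SignCube d → ℝ) (g : Fin n → SignCube d → ℝ)
    (hf : ∀ i, cubeAvg (fun x => f i x ^ 2) ≤ α ^ 2)
    (hg : ∀ j, cubeAvg (fun x => g j x ^ 2) ≤ β ^ 2) :
    ∑ i, ∑ j, A i j * cubeAvg (fun x => f i x * g j x) ≤ α * β * sSup (hilbertValues A) := by
  have hc : (0 : ℝ) < 2 ^ d := by positivity
  have hr : (0 : ℝ) < √(2 ^ d) := Real.sqrt_pos.2 hc
  have hr2 : √((2 : ℝ) ^ d) ^ 2 = 2 ^ d := Real.sq_sqrt hc.le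
  refine le_trans (le_of_eq ?_) (sum_le_sSup_hilbertValues A hα hβ
    (fun i x => f i x / √(2 ^ d)) (fun j x => g j x / √(2 ^ d)) ?_ ?_)
  · refine Finset.sum_congr rfl fun i _ => Finset.sum_congr rfl fun j _ => ?_
    rw [cubeAvg, Finset.sum_div]
    congr 1
    refine Finset.sum_congr rfl fun x _ => ?_
    rw [div_mul_div_comm, ← sq, hr2]
  · intro i
    simp only [div_pow, hr2, ← Finset.sum_div]
    exact hf i
  · intro j
    simp only [div_pow, hr2, ← Finset.sum_div]
    exact hg j

/-- Grothendieck's inequality, with the constant `6`. -/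
theorem grothendieck_inequality {m n : ℕ} {A : Fin m → Fin n → ℝ} {M : ℝ}
    (hA : ∀ (x : SignCube m) (y : SignCube n),
      ∑ i, ∑ j, A i j * signVal x i * signVal y j ≤ M) :
    sSup (hilbertValues A) ≤ 6 * M := by
  set K := sSup (hilbertValues A) with hK
  have hne : (hilbertValues A).Nonempty :=
    ⟨_, 0, fun _ _ => 0, fun _ _ => 0, by simp, by simp, rfl⟩
  -- With `X`, `Y` the Rademacher sums of `u i`, `v j` and `X'`, `Y'` their clippings, `⟨u i, v j⟩ =
  -- E XY` and `XY = (X - X')Y + X'(Y - Y') + X'Y'`. At level `√3` the tails have `L²` norm at most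
  -- `1/4`, as `3 / (16 · 3) = (1/4)²`, so the first two terms contribute `K/4` each. The last is a
  -- bilinear form on entries bounded by `√3`, hence at most `3M`.
  have main : ∀ r ∈ hilbertValues A, r ≤ 3 * M + K / 2 := by
    rintro r ⟨d, u, v, hu, hv, rfl⟩
    have h3 : (0 : ℝ) < √3 := by positivity
    have h33 : √(3 : ℝ) ^ 2 = 3 := Real.sq_sqrt (by norm_num)
    have var : ∀ w : Fin d → ℝ, ∑ k, w k ^ 2 ≤ 1 → cubeAvg (fun x => radSum w x ^ 2) ≤ 1 ^ 2 := by
      intro w hw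
      have := cubeAvg_radSum_mul w w
      simp only [← sq] at this
      rw [this, one_pow]
      exact hw
    have varc : ∀ w : Fin d → ℝ, ∑ k, w k ^ 2 ≤ 1 →
        cubeAvg (fun x => clip √3 (radSum w x) ^ 2) ≤ 1 ^ 2 := fun w hw =>
      (cubeAvg_mono fun x => clip_sq_le h3.le _).trans (var w hw)
    have vart : ∀ w : Fin d → ℝ, ∑ k, w k ^ 2 ≤ 1 →
        cubeAvg (fun x => (radSum w x - clip √3 (radSum w x)) ^ 2) ≤ (1 / 4) ^ 2 := by
      intro w hw
      have h0 : 0 ≤ ∑ k, w k ^ 2 := Finset.sum_nonneg fun _ _ => sq_nonneg _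
      calc cubeAvg (fun x => (radSum w x - clip √3 (radSum w x)) ^ 2)
          ≤ cubeAvg (fun x => 1 / 48 * radSum w x ^ 4) := by
            refine cubeAvg_mono fun x => (sub_clip_sq_le h3 _).trans (le_of_eq ?_)
            rw [h33]
            ring
        _ ≤ 1 / 48 * (3 * (∑ k, w k ^ 2) ^ 2) := by
            rw [cubeAvg_const_mul]
            gcongr
            exact cubeAvg_radSum_pow_four_le w
        _ ≤ _ := by nlinarith
    have t1 := sum_cubeAvg_le_sSup_hilbertValues A (by norm_num) one_pos
      (fun i x => radSum (u i) x - clip √3 (radSum (u i) x)) (fun j => radSum (v j))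
      (fun i => vart _ (hu i)) (fun j => var _ (hv j))
    have t2 := sum_cubeAvg_le_sSup_hilbertValues A one_pos (by norm_num)
      (fun i x => clip √3 (radSum (u i) x)) (fun j x => radSum (v j) x - clip √3 (radSum (v j) x))
      (fun i => varc _ (hu i)) (fun j => vart _ (hv j))
    have t3 : ∑ i, ∑ j, A i j *
        cubeAvg (fun x => clip √3 (radSum (u i) x) * clip √3 (radSum (v j) x)) ≤ 3 * M := by
      calc _ = cubeAvg (fun x => ∑ i, ∑ j, A i j *
              (clip √3 (radSum (u i) x) * clip √3 (radSum (v j) x))) := by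
            simp only [cubeAvg_sum, cubeAvg_const_mul]
        _ ≤ cubeAvg (fun _ : SignCube d => 3 * M) := by
            refine cubeAvg_mono fun x => ?_
            have := bilin_le_of_sign hA (s := fun i => clip √3 (radSum (u i) x) / √3)
              (t := fun j => clip √3 (radSum (v j) x) / √3)
              (fun i => by
                rw [abs_div, abs_of_pos h3]; exact div_le_one_of_le₀ (abs_clip_le h3.le _) h3.le)
              (fun i => by
                rw [abs_div, abs_of_pos h3]; exact div_le_one_of_le₀ (abs_clip_le h3.le _) h3.le)
            refine le_trans (le_of_eq ?_) (mul_le_mul_of_nonneg_left this (by norm_num : (0:ℝ) ≤ 3))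
            simp only [Finset.mul_sum]
            refine Finset.sum_congr rfl fun i _ => Finset.sum_congr rfl fun j _ => ?_
            field_simp
            rw [h33]
        _ = 3 * M := cubeAvg_const _
    have split : ∑ i, ∑ j, A i j * ∑ k, u i k * v j k =
        ∑ i, ∑ j, A i j * cubeAvg (fun x => (radSum (u i) x - clip √3 (radSum (u i) x)) *
          radSum (v j) x) +
        ∑ i, ∑ j, A i j * cubeAvg (fun x => clip √3 (radSum (u i) x) *
          (radSum (v j) x - clip √3 (radSum (v j) x))) +
        ∑ i, ∑ j, A i j *
          cubeAvg (fun x => clip √3 (radSum (u i) x) * clip √3 (radSum (v j) x)) := by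
      simp only [← Finset.sum_add_distrib, ← mul_add, ← cubeAvg_add]
      refine Finset.sum_congr rfl fun i _ => Finset.sum_congr rfl fun j _ => ?_
      rw [← cubeAvg_radSum_mul]
      congr 2
      funext x
      ring
    rw [split]
    linarith
  have := csSup_le hne main
  linarith

/-! ### Change of density. -/

/-- In `ℓ²` of the cube, pair the unit vectors `(√(w x) x_j)_x` with the normalization of `(√(w x)
(Ax)_i)_x`. If `Y i = 0`, division by zero makes the latter the zero vector, which is still
admissible. -/
lemma sum_sqrt_le_sSup_hilbertValues {m n : ℕ} (A : Fin m → Fin n → ℝ) {w : SignCube n → ℝ}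
    (hw : w ∈ stdSimplex ℝ (SignCube n)) :
    ∑ i, √(∑ x, w x * (∑ j, A i j * signVal x j) ^ 2) ≤ sSup (hilbertValues A) := by
  set Y : Fin m → ℝ := fun i => √(∑ x, w x * (∑ j, A i j * signVal x j) ^ 2) with hY
  have hY2 : ∀ i, Y i ^ 2 = ∑ x, w x * (∑ j, A i j * signVal x j) ^ 2 := fun i =>
    Real.sq_sqrt (Finset.sum_nonneg fun x _ => mul_nonneg (hw.1 x) (sq_nonneg _))
  have hsq : ∀ x, √(w x) ^ 2 = w x := fun x => Real.sq_sqrt (hw.1 x)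
  have key := sum_le_sSup_hilbertValues A one_pos one_pos
    (fun i (x : SignCube n) => √(w x) * (∑ j, A i j * signVal x j) / Y i)
    (fun j x => √(w x) * signVal x j) (fun i => ?_) (fun j => ?_)
  · rw [one_mul, one_mul] at key
    refine le_trans (le_of_eq (Finset.sum_congr rfl fun i _ => ?_)) key
    calc Y i = Y i ^ 2 / Y i := by
          rcases eq_or_ne (Y i) 0 with h | h
          · simp [h]
          · field_simp
      _ = ∑ x, ∑ j, A i j * (√(w x) * (∑ j, A i j * signVal x j) / Y i *
            (√(w x) * signVal x j)) := by
          rw [hY2, Finset.sum_div]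
          refine Finset.sum_congr rfl fun x _ => ?_
          calc w x * (∑ j, A i j * signVal x j) ^ 2 / Y i
              = √(w x) ^ 2 * (∑ j, A i j * signVal x j) / Y i * ∑ j, A i j * signVal x j := by
                rw [hsq]; ring
            _ = _ := by
                rw [Finset.mul_sum]
                exact Finset.sum_congr rfl fun j _ => by ring
      _ = _ := by
          rw [Finset.sum_comm]
          simp only [Finset.mul_sum]
  · simp only [div_pow, mul_pow, hsq, ← Finset.sum_div]
    rw [← hY2, one_pow]
    exact div_self_le_one _
  · simp only [mul_pow, hsq, signVal_sq, mul_one]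
    rw [hw.2, one_pow]

/-- First-order optimality for a sum of square roots along a segment. -/
lemma sum_div_nonpos_of_sum_sqrt_le {ι : Type*} [Fintype ι] {s b : ι → ℝ} (hs : ∀ i, 0 < s i)
    (hnn : ∀ t ∈ Set.Ioc (0 : ℝ) 1, ∀ i, 0 ≤ s i ^ 2 + t * b i)
    (hle : ∀ t ∈ Set.Ioc (0 : ℝ) 1, ∑ i, √(s i ^ 2 + t * b i) ≤ ∑ i, s i) :
    ∑ i, b i / s i ≤ 0 := by
  -- Rationalizing, `(√(s² + tb) - s) / t = b / (√(s² + tb) + s)`, whose right side is continuous at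
  -- `t = 0` with value `b / (2s)`.
  have hden : ∀ t i, 0 < √(s i ^ 2 + t * b i) + s i := fun t i =>
    add_pos_of_nonneg_of_pos (Real.sqrt_nonneg _) (hs i)
  have hcont : Continuous fun t : ℝ => ∑ i, b i / (√(s i ^ 2 + t * b i) + s i) := by
    refine continuous_finsetSum _ fun i _ => Continuous.div (by fun_prop) (by fun_prop) ?_
    exact fun t => (hden t i).ne'
  have hlim := (hcont.tendsto 0).mono_left (nhdsWithin_le_nhds (s := Set.Ioi 0))
  have hev : ∀ᶠ t in nhdsWithin (0 : ℝ) (Set.Ioi 0),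
      ∑ i, b i / (√(s i ^ 2 + t * b i) + s i) ≤ 0 := by
    filter_upwards [Ioc_mem_nhdsGT (zero_lt_one' ℝ)] with t ht
    have h1 : t * ∑ i, b i / (√(s i ^ 2 + t * b i) + s i) =
        ∑ i, √(s i ^ 2 + t * b i) - ∑ i, s i := by
      rw [← Finset.sum_sub_distrib, Finset.mul_sum]
      refine Finset.sum_congr rfl fun i _ => ?_
      rw [← mul_div_assoc, div_eq_iff (hden t i).ne']
      have := Real.sq_sqrt (hnn t ht i)
      linear_combination -this
    have h2 := hle t ht
    by_contra! h
    have := mul_pos ht.1 h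
    linarith
  have h := le_of_tendsto hlim hev
  simp only [zero_mul, add_zero, Real.sqrt_sq (hs _).le, ← two_mul] at h
  have h' : ∑ i, b i / (2 * s i) = (∑ i, b i / s i) / 2 := by
    rw [Finset.sum_div]
    exact Finset.sum_congr rfl fun i _ => by rw [div_div, mul_comm]
  linarith

/-- A change of density for bilinear forms that are bounded on signs. -/
theorem exists_weights_of_bilin_le {m n : ℕ} {A : Fin m → Fin n → ℝ} {M : ℝ}
    (hA : ∀ (x : SignCube m) (y : SignCube n),
      ∑ i, ∑ j, A i j * signVal x i * signVal y j ≤ M) :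
    ∃ s : Fin m → ℝ, (∀ i, 0 < s i) ∧ ∑ i, s i ≤ 6 * M + 1 ∧
      ∀ x : SignCube n, ∑ i, (∑ j, A i j * signVal x j) ^ 2 / s i ≤ 6 * M + 1 := by
  -- The regularization keeps every `s i` positive, and its total cost `m √η = m / (m + 1)` is at
  -- most `1`.
  set η : ℝ := (1 / (m + 1)) ^ 2 with hη
  have hη0 : 0 < η := by positivity
  set c : SignCube n → Fin m → ℝ := fun x i => (∑ j, A i j * signVal x j) ^ 2 with hc
  have hc0 : ∀ x i, 0 ≤ c x i := fun x i => sq_nonneg _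
  let F : (SignCube n → ℝ) → ℝ := fun w => ∑ i, √(η + ∑ x, w x * c x i)
  have hF : Continuous F := by fun_prop
  obtain ⟨w, hw, hmax⟩ := (isCompact_stdSimplex ℝ (SignCube n)).exists_isMaxOn
    ⟨_, single_mem_stdSimplex ℝ (1 : SignCube n)⟩ hF.continuousOn
  have hpos : ∀ w ∈ stdSimplex ℝ (SignCube n), ∀ i, 0 < η + ∑ x, w x * c x i := fun w hw i =>
    add_pos_of_pos_of_nonneg hη0 (Finset.sum_nonneg fun x _ => mul_nonneg (hw.1 x) (hc0 x i))
  set s : Fin m → ℝ := fun i => √(η + ∑ x, w x * c x i) with hs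
  have hs0 : ∀ i, 0 < s i := fun i => Real.sqrt_pos.2 (hpos w hw i)
  have hs2 : ∀ i, s i ^ 2 = η + ∑ x, w x * c x i := fun i => Real.sq_sqrt (hpos w hw i).le
  have hsum : ∑ i, s i ≤ 6 * M + 1 := by
    have h1 : ∀ i, s i ≤ 1 / (m + 1) + √(∑ x, w x * c x i) := by
      intro i
      have h0 : 0 ≤ ∑ x, w x * c x i :=
        Finset.sum_nonneg fun x _ => mul_nonneg (hw.1 x) (hc0 x i)
      have h2 : (0 : ℝ) ≤ 1 / (m + 1) := by positivity
      refine Real.sqrt_le_iff.2 ⟨by positivity, ?_⟩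
      have := Real.sq_sqrt h0
      nlinarith [mul_nonneg h2 (Real.sqrt_nonneg (∑ x, w x * c x i))]
    calc ∑ i, s i ≤ ∑ i, (1 / ((m : ℝ) + 1) + √(∑ x, w x * c x i)) :=
          Finset.sum_le_sum fun i _ => h1 i
      _ = m / (m + 1) + ∑ i, √(∑ x, w x * c x i) := by
          rw [Finset.sum_add_distrib]
          simp [div_eq_mul_inv]
      _ ≤ 1 + 6 * M := by
          refine add_le_add (div_le_one_of_le₀ (by linarith) (by positivity)) ?_
          exact (sum_sqrt_le_sSup_hilbertValues A hw).trans (grothendieck_inequality hA)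
      _ = _ := by ring
  refine ⟨s, hs0, hsum, fun x => ?_⟩
  let e : SignCube n → ℝ := Pi.single x 1
  have hseg : ∀ t ∈ Set.Ioc (0 : ℝ) 1,
      (1 - t) • w + t • e ∈ stdSimplex ℝ (SignCube n) := fun t ht =>
    convex_stdSimplex ℝ (SignCube n) hw (single_mem_stdSimplex ℝ x) (by linarith [ht.2])
      ht.1.le (by ring)
  have hval : ∀ t i, η + ∑ y, ((1 - t) • w + t • e) y * c y i =
      s i ^ 2 + t * (c x i - (s i ^ 2 - η)) := by
    intro t i
    have : ∑ y, ((1 - t) • w + t • e) y * c y i =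
        (1 - t) * ∑ y, w y * c y i + t * c x i := by
      simp only [Pi.add_apply, Pi.smul_apply, smul_eq_mul, add_mul, Finset.sum_add_distrib,
        Finset.mul_sum, mul_assoc]
      congr 1
      simp [e, Pi.single_apply]
    rw [this, hs2]
    ring
  -- Moving from the maximizer `w` towards the point mass at `x` cannot increase `F`.
  have hopt := sum_div_nonpos_of_sum_sqrt_le (b := fun i => c x i - (s i ^ 2 - η)) hs0
    (fun t ht i => by rw [← hval]; exact (hpos _ (hseg t ht) i).le)
    (fun t ht => by simp only [← hval]; exact hmax (hseg t ht))
  calc ∑ i, c x i / s i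
      = ∑ i, (c x i - (s i ^ 2 - η)) / s i + ∑ i, (s i ^ 2 - η) / s i := by
        rw [← Finset.sum_add_distrib]
        exact Finset.sum_congr rfl fun i _ => by ring
    _ ≤ 0 + ∑ i, s i := by
        refine add_le_add hopt (Finset.sum_le_sum fun i _ => ?_)
        rw [div_le_iff₀ (hs0 i)]
        nlinarith
    _ ≤ _ := by linarith

/-! ### Quadratic representation on the cube. -/

lemma exists_quadratic_repr {N : ℕ} (p : MvPolynomial (Fin N) ℝ) (hp : p.totalDegree ≤ 2) :
    ∃ (c : ℝ) (b : Fin N → ℝ) (A : Fin N → Fin N → ℝ), ∀ x : SignCube N,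
      cubeEval p x = c + ∑ i, b i * signVal x i + ∑ i, ∑ j, A i j * signVal x i * signVal x j := by
  have main : ∀ S ⊆ p.support, ∃ (c : ℝ) (b : Fin N → ℝ) (A : Fin N → Fin N → ℝ),
      ∀ x : SignCube N, ∑ d ∈ S, p.coeff d * (d.toMultiset.map (signVal x)).prod =
        c + ∑ i, b i * signVal x i + ∑ i, ∑ j, A i j * signVal x i * signVal x j := by
    intro S
    induction S using Finset.induction_on with
    | empty => exact fun _ => ⟨0, 0, 0, fun x => by simp⟩
    | insert d S hd ih =>
      intro hS
      obtain ⟨c, b, A, h⟩ := ih ((Finset.subset_insert _ _).trans hS)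
      have hcard : d.toMultiset.card ≤ 2 := by
        rw [Finsupp.card_toMultiset]
        exact (MvPolynomial.le_totalDegree (hS (Finset.mem_insert_self _ _))).trans hp
      simp only [Finset.sum_insert hd, h]
      generalize p.coeff d = a
      interval_cases hk : d.toMultiset.card
      · rw [Multiset.card_eq_zero] at hk
        refine ⟨a + c, b, A, fun x => ?_⟩
        rw [hk]
        simp only [Multiset.map_zero, Multiset.prod_zero]
        ring
      · obtain ⟨i, hi⟩ := Multiset.card_eq_one.1 hk
        refine ⟨c, b + Pi.single i a, A, fun x => ?_⟩
        rw [hi]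
        simp only [Multiset.map_singleton, Multiset.prod_singleton, Pi.add_apply, add_mul,
          Finset.sum_add_distrib]
        rw [Finset.sum_eq_single i (f := fun k => (Pi.single i a : Fin N → ℝ) k * signVal x k)
          (by intro k _ hk; simp [hk]) (by simp)]
        simp only [Pi.single_eq_same]
        ring
      · obtain ⟨i, j, hij⟩ := Multiset.card_eq_two.1 hk
        refine ⟨c, b, A + fun k l => if k = i ∧ l = j then a else 0, fun x => ?_⟩
        rw [hij]
        simp only [Multiset.insert_eq_cons, Multiset.map_cons, Multiset.map_singleton,
          Multiset.prod_cons, Multiset.prod_singleton, Pi.add_apply, add_mul,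
          Finset.sum_add_distrib]
        have : ∑ k, ∑ l, (if k = i ∧ l = j then a else 0) * signVal x k * signVal x l =
            a * signVal x i * signVal x j := by
          simp [ite_and, ite_mul]
        rw [this]
        ring
  obtain ⟨c, b, A, h⟩ := main p.support subset_rfl
  refine ⟨c, b, A, fun x => ?_⟩
  rw [← h, cubeEval, MvPolynomial.eval_eq']
  refine Finset.sum_congr rfl fun d _ => ?_
  rw [Finsupp.toMultiset_map, Finsupp.prod_toMultiset,
    Finsupp.prod_mapDomain_index (fun _ => pow_zero _) (fun _ _ _ => pow_add _ _ _),
    Finsupp.prod_fintype _ _ fun _ => pow_zero _]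
  rfl

/-- On the cube, a polynomial of degree at most `2` is given by a constant, a linear form and a
symmetric bilinear form without diagonal. -/
lemma exists_symm_quadratic_repr {N : ℕ} (p : MvPolynomial (Fin N) ℝ) (hp : p.totalDegree ≤ 2) :
    ∃ (c : ℝ) (b : Fin N → ℝ) (A : Fin N → Fin N → ℝ), (∀ i j, A i j = A j i) ∧
      (∀ i, A i i = 0) ∧ ∀ x : SignCube N,
      cubeEval p x = c + ∑ i, b i * signVal x i + ∑ i, ∑ j, A i j * signVal x i * signVal x j := by
  obtain ⟨c, b, A, h⟩ := exists_quadratic_repr p hp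
  -- Since `x_i² = 1`, the diagonal joins the constant term.
  refine ⟨c + ∑ i, A i i, b, fun i j => (A i j + A j i) / 2 - if i = j then A i i else 0,
    fun i j => ?_, fun i => ?_, fun x => ?_⟩
  · rcases eq_or_ne i j with rfl | hij
    · rfl
    · simp [hij, hij.symm, add_comm]
  · simp
  · have h1 : ∑ i, ∑ j, A j i * signVal x i * signVal x j =
        ∑ i, ∑ j, A i j * signVal x i * signVal x j := by
      rw [Finset.sum_comm]
      exact Finset.sum_congr rfl fun i _ => Finset.sum_congr rfl fun j _ => by ring
    have h2 : ∑ i, ∑ j, (if i = j then A i i else 0) * signVal x i * signVal x j =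
        ∑ i, A i i := by
      simp [ite_mul, mul_assoc, signVal_mul_self]
    have h3 : ∑ i, ∑ j, ((A i j + A j i) / 2 - if i = j then A i i else 0) *
        signVal x i * signVal x j =
        (∑ i, ∑ j, A i j * signVal x i * signVal x j) / 2 +
        (∑ i, ∑ j, A j i * signVal x i * signVal x j) / 2 -
        ∑ i, ∑ j, (if i = j then A i i else 0) * signVal x i * signVal x j := by
      simp only [Finset.sum_div, ← Finset.sum_add_distrib, ← Finset.sum_sub_distrib]
      exact Finset.sum_congr rfl fun i _ => Finset.sum_congr rfl fun j _ => by ring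
    rw [h, h3, h1, h2]
    ring

/-! ### Consequences of boundedness, and the sampling distribution. -/

section Bounded

variable {N : ℕ} {c : ℝ} {b : Fin N → ℝ} {A : Fin N → Fin N → ℝ}

lemma sum_abs_linear_le_one (h : ∀ x : SignCube N,
    |c + ∑ i, b i * signVal x i + ∑ i, ∑ j, A i j * signVal x i * signVal x j| ≤ 1) :
    ∑ i, |b i| ≤ 1 := by
  refine sum_abs_le_of_forall_sign fun x => ?_
  have h1 := (abs_le.1 (h x)).2
  have h2 := (abs_le.1 (h (-x))).1
  simp only [signVal_neg, mul_neg, neg_mul, neg_neg, Finset.sum_neg_distrib] at h2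
  linarith

lemma abs_even_part_le_one (h : ∀ x : SignCube N,
    |c + ∑ i, b i * signVal x i + ∑ i, ∑ j, A i j * signVal x i * signVal x j| ≤ 1)
    (x : SignCube N) : |c + ∑ i, ∑ j, A i j * signVal x i * signVal x j| ≤ 1 := by
  have h1 := abs_le.1 (h x)
  have h2 := abs_le.1 (h (-x))
  simp only [signVal_neg, mul_neg, neg_mul, neg_neg, Finset.sum_neg_distrib] at h2
  exact abs_le.2 ⟨by linarith [h1.1, h2.1], by linarith [h1.2, h2.2]⟩

lemma cubeAvg_signVal (i : Fin N) : cubeAvg (fun x => signVal x i) = 0 := by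
  have h : radSum (Pi.single i (1 : ℝ)) = fun x => signVal x i := by
    funext x
    simp [radSum, Pi.single_apply, ite_mul]
  rw [← h, cubeAvg_radSum]

lemma cubeAvg_signVal_mul (i j : Fin N) :
    cubeAvg (fun x => signVal x i * signVal x j) = if i = j then 1 else 0 := by
  have := cubeAvg_radSum_mul (Pi.single i (1 : ℝ)) (Pi.single j (1 : ℝ))
  simpa [radSum, Pi.single_apply, ite_mul, eq_comm] using this

lemma cubeAvg_quadratic_shift (hd : ∀ i, A i i = 0) (z d : Fin N → ℝ) :
    cubeAvg (fun x => c + ∑ i, ∑ j, A i j * (z i + d i * signVal x i) *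
      (z j + d j * signVal x j)) = c + ∑ i, ∑ j, A i j * z i * z j := by
  rw [cubeAvg_add, cubeAvg_const]
  simp only [cubeAvg_sum]
  congr 1
  refine Finset.sum_congr rfl fun i _ => Finset.sum_congr rfl fun j _ => ?_
  have h : ∀ x : SignCube N, A i j * (z i + d i * signVal x i) * (z j + d j * signVal x j) =
      A i j * z i * z j + (A i j * z i * d j * signVal x j + (A i j * z j * d i * signVal x i +
        A i j * d i * d j * (signVal x i * signVal x j))) := fun x => by ring
  simp only [h, cubeAvg_add, cubeAvg_const, cubeAvg_const_mul, cubeAvg_signVal,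
    cubeAvg_signVal_mul]
  rcases eq_or_ne i j with rfl | hij
  · simp [hd]
  · simp [hij]

/-- The midpoint has zeros where `x` and `y` differ. Replacing these by independent random signs
gives a point of the cube, and without diagonal terms the expected value of the form is its value at
the midpoint. -/
lemma abs_quadratic_midpoint_le_one (hd : ∀ i, A i i = 0)
    (h : ∀ x : SignCube N, |c + ∑ i, ∑ j, A i j * signVal x i * signVal x j| ≤ 1)
    (x y : SignCube N) :
    |c + ∑ i, ∑ j, A i j * ((signVal x i + signVal y i) / 2) *
      ((signVal x j + signVal y j) / 2)| ≤ 1 := by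
  have hw : ∀ (r : SignCube N) (i : Fin N),
      signVal (fun i => if x i = y i then x i else x i * r i) i =
        (signVal x i + signVal y i) / 2 + (signVal x i - signVal y i) / 2 * signVal r i := by
    intro r i
    unfold signVal
    rcases Int.units_eq_one_or (x i) with hx | hx <;>
      rcases Int.units_eq_one_or (y i) with hy | hy <;>
      (simp [hx, hy]; try norm_num)
  have hpt : ∀ r : SignCube N, |c + ∑ i, ∑ j, A i j *
      ((signVal x i + signVal y i) / 2 + (signVal x i - signVal y i) / 2 * signVal r i) *
      ((signVal x j + signVal y j) / 2 + (signVal x j - signVal y j) / 2 * signVal r j)| ≤ 1 := by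
    intro r
    have := h (fun i => if x i = y i then x i else x i * r i)
    simpa only [hw] using this
  rw [← cubeAvg_quadratic_shift hd _ (fun i => (signVal x i - signVal y i) / 2), abs_le]
  constructor
  · rw [← cubeAvg_const (n := N) (-1)]
    exact cubeAvg_mono fun r => (abs_le.1 (hpt r)).1
  · rw [← cubeAvg_const (n := N) 1]
    exact cubeAvg_mono fun r => (abs_le.1 (hpt r)).2

/-- Polarization: the form at `(x + y)/2` minus the form at `(x - y)/2` is `xᵀAy`; the constant `c`
cancels. -/
lemma bilin_le_two (hs : ∀ i j, A i j = A j i) (hd : ∀ i, A i i = 0)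
    (h : ∀ x : SignCube N, |c + ∑ i, ∑ j, A i j * signVal x i * signVal x j| ≤ 1)
    (x y : SignCube N) : ∑ i, ∑ j, A i j * signVal x i * signVal y j ≤ 2 := by
  have h1 := (abs_le.1 (abs_quadratic_midpoint_le_one hd h x y)).2
  have h2 := (abs_le.1 (abs_quadratic_midpoint_le_one hd h x (-y))).1
  have h3 : ∑ i, ∑ j, A i j * signVal y i * signVal x j =
      ∑ i, ∑ j, A i j * signVal x i * signVal y j := by
    rw [Finset.sum_comm]
    exact Finset.sum_congr rfl fun i _ => Finset.sum_congr rfl fun j _ => by rw [hs]; ring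
  have h4 : ∑ i, ∑ j, A i j * ((signVal x i + signVal y i) / 2) *
        ((signVal x j + signVal y j) / 2) -
      ∑ i, ∑ j, A i j * ((signVal x i + signVal (-y) i) / 2) *
        ((signVal x j + signVal (-y) j) / 2) =
      (∑ i, ∑ j, A i j * signVal x i * signVal y j) / 2 +
        (∑ i, ∑ j, A i j * signVal y i * signVal x j) / 2 := by
    simp only [Finset.sum_div, ← Finset.sum_add_distrib, ← Finset.sum_sub_distrib, signVal_neg]
    exact Finset.sum_congr rfl fun i _ => Finset.sum_congr rfl fun j _ => by ring
  linarith

/-- Sampling probabilities for the coordinates that keep all variances bounded. -/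
lemma exists_sampling_weights (hN : 0 < N)
    (hA : ∀ x y : SignCube N, ∑ i, ∑ j, A i j * signVal x i * signVal y j ≤ 2)
    (hb : ∑ i, |b i| ≤ 1) :
    ∃ v : Fin N → ℝ, (∀ i, 0 < v i) ∧ ∑ i, v i = 1 ∧
      (∀ x : SignCube N, ∑ i, (∑ j, A i j * signVal x j) ^ 2 / v i ≤ 195) ∧
      ∑ i, b i ^ 2 / v i ≤ 15 ∧ ∑ i, ∑ j, A i j ^ 2 / (v i * v j) ≤ 2925 * N := by
  obtain ⟨s, hs0, hs, hx⟩ := exists_weights_of_bilin_le hA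
  have hN' : (0 : ℝ) < N := by exact_mod_cast hN
  -- The three parts of `v` control the rows of `A`, the linear form and `1 / v i`. Their totals are
  -- at most `6 · 2 + 1 = 13`, `1` and `1`, hence `T ≤ 15`.
  set T : ℝ := ∑ i, s i + ∑ i, |b i| + 1 with hT
  have hsn : 0 ≤ ∑ i, s i := Finset.sum_nonneg fun i _ => (hs0 i).le
  have hbn : 0 ≤ ∑ i, |b i| := Finset.sum_nonneg fun i _ => abs_nonneg _
  have hT0 : 0 < T := by positivity
  have hT15 : T ≤ 15 := by linarith
  set v : Fin N → ℝ := fun i => (s i + |b i| + 1 / N) / T with hv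
  have hv0 : ∀ i, 0 < v i := fun i => by
    have := hs0 i
    positivity
  have hbnd : ∀ i, ∀ r, 0 < r → r ≤ s i + |b i| + 1 / N → 1 / v i ≤ 15 / r := by
    intro i r hr hle
    have h1 : r / T ≤ v i := div_le_div_of_nonneg_right hle hT0.le
    calc 1 / v i ≤ 1 / (r / T) := one_div_le_one_div_of_le (by positivity) h1
      _ = T / r := one_div_div _ _
      _ ≤ 15 / r := div_le_div_of_nonneg_right hT15 hr.le
  have hinv : (0 : ℝ) < 1 / N := by positivity
  have hvs : ∀ i, 1 / v i ≤ 15 / s i := fun i =>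
    hbnd i _ (hs0 i) (by linarith [abs_nonneg (b i)])
  have hvN : ∀ i, 1 / v i ≤ 15 * N := fun i => by
    have := hbnd i (1 / N) hinv (by linarith [abs_nonneg (b i), hs0 i])
    exact this.trans (le_of_eq (by field_simp))
  have hxv : ∀ x : SignCube N, ∑ i, (∑ j, A i j * signVal x j) ^ 2 / v i ≤ 195 := by
    intro x
    calc ∑ i, (∑ j, A i j * signVal x j) ^ 2 / v i
        ≤ ∑ i, 15 * ((∑ j, A i j * signVal x j) ^ 2 / s i) := by
          refine Finset.sum_le_sum fun i _ => ?_
          rw [div_eq_mul_one_div]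
          refine (mul_le_mul_of_nonneg_left (hvs i) (sq_nonneg _)).trans (le_of_eq (by ring))
      _ ≤ 15 * (6 * 2 + 1) := by
          rw [← Finset.mul_sum]
          gcongr
          exact hx x
      _ = 195 := by norm_num
  refine ⟨v, hv0, ?_, hxv, ?_, ?_⟩
  · rw [← Finset.sum_div, div_eq_one_iff_eq hT0.ne', Finset.sum_add_distrib,
      Finset.sum_add_distrib, hT]
    simp [hN'.ne']
  · calc ∑ i, b i ^ 2 / v i ≤ ∑ i, 15 * |b i| := by
          refine Finset.sum_le_sum fun i _ => ?_
          rcases eq_or_ne (b i) 0 with h0 | h0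
          · simp [h0]
          · have hp := abs_pos.2 h0
            have := hbnd i |b i| hp (by linarith [hs0 i])
            rw [div_eq_mul_one_div]
            refine (mul_le_mul_of_nonneg_left this (sq_nonneg _)).trans (le_of_eq ?_)
            rw [← sq_abs]
            field_simp
      _ ≤ 15 := by
          rw [← Finset.mul_sum]
          linarith
  -- The average of `(Ax)_i²` over the cube is `∑ j, A i j²`.
  · have havg : ∑ i, ∑ j, A i j ^ 2 / v i ≤ 195 := by
      calc ∑ i, ∑ j, A i j ^ 2 / v i
          = cubeAvg (fun x : SignCube N => ∑ i, (∑ j, A i j * signVal x j) ^ 2 / v i) := by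
            rw [cubeAvg_sum]
            refine Finset.sum_congr rfl fun i _ => ?_
            have := cubeAvg_radSum_mul (A i) (A i)
            simp only [← sq] at this
            rw [← Finset.sum_div, ← this, div_eq_inv_mul, ← cubeAvg_const_mul]
            simp only [radSum, div_eq_inv_mul]
        _ ≤ 195 := by
            rw [← cubeAvg_const (n := N) 195]
            exact cubeAvg_mono hxv
    calc ∑ i, ∑ j, A i j ^ 2 / (v i * v j) ≤ ∑ i, ∑ j, 15 * N * (A i j ^ 2 / v i) := by
          refine Finset.sum_le_sum fun i _ => Finset.sum_le_sum fun j _ => ?_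
          rw [← div_div, div_eq_mul_one_div]
          have h0 : 0 ≤ A i j ^ 2 / v i := div_nonneg (sq_nonneg _) (hv0 i).le
          exact (mul_le_mul_of_nonneg_left (hvN j) h0).trans (le_of_eq (by ring))
      _ = 15 * N * ∑ i, ∑ j, A i j ^ 2 / v i := by simp only [Finset.mul_sum]
      _ ≤ 15 * N * 195 := by gcongr
      _ = 2925 * N := by ring

end Bounded

/-! ### Moments of empirical means and of grid means. -/

section Sampling

variable {ι : Type*} [Fintype ι]

/-- The expectation of `F` over `m` independent samples from the distribution `v`. -/
noncomputable def sampleAvg (v : ι → ℝ) {m : ℕ} (F : (Fin m → ι) → ℝ) : ℝ :=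
  ∑ a, (∏ k, v (a k)) * F a

variable {v : ι → ℝ}

lemma sampleAvg_add {m : ℕ} (F G : (Fin m → ι) → ℝ) :
    sampleAvg v (fun a => F a + G a) = sampleAvg v F + sampleAvg v G := by
  simp only [sampleAvg, mul_add, Finset.sum_add_distrib]

lemma sampleAvg_const_mul {m : ℕ} (r : ℝ) (F : (Fin m → ι) → ℝ) :
    sampleAvg v (fun a => r * F a) = r * sampleAvg v F := by
  simp only [sampleAvg, Finset.mul_sum]
  exact Finset.sum_congr rfl fun a _ => by ring

lemma sampleAvg_sum {m : ℕ} {κ : Type*} (s : Finset κ) (F : κ → (Fin m → ι) → ℝ) :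
    sampleAvg v (fun a => ∑ k ∈ s, F k a) = ∑ k ∈ s, sampleAvg v (F k) := by
  simp only [sampleAvg, Finset.mul_sum]
  exact Finset.sum_comm

lemma sampleAvg_mono (hv : ∀ i, 0 ≤ v i) {m : ℕ} {F G : (Fin m → ι) → ℝ} (h : ∀ a, F a ≤ G a) :
    sampleAvg v F ≤ sampleAvg v G :=
  Finset.sum_le_sum fun a _ =>
    mul_le_mul_of_nonneg_left (h a) (Finset.prod_nonneg fun _ _ => hv _)

lemma sum_prod_weights (hv : ∑ i, v i = 1) (m : ℕ) : ∑ a : Fin m → ι, ∏ k, v (a k) = 1 := by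
  classical
  rw [← Fintype.piFinset_univ, ← Finset.prod_univ_sum (fun _ => Finset.univ) fun _ i => v i]
  simp [hv]

lemma sampleAvg_const (hv : ∑ i, v i = 1) {m : ℕ} (r : ℝ) :
    sampleAvg v (fun _ : Fin m → ι => r) = r := by
  rw [sampleAvg, ← Finset.sum_mul, sum_prod_weights hv, one_mul]

lemma sampleAvg_succ {m : ℕ} (F : (Fin (m + 1) → ι) → ℝ) :
    sampleAvg v F = ∑ i, v i * sampleAvg v (fun a : Fin m → ι => F (Fin.cons i a)) := by
  have h : sampleAvg v F = ∑ i, ∑ a : Fin m → ι,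
      (∏ k, v ((Fin.cons i a : Fin (m + 1) → ι) k)) * F (Fin.cons i a) := by
    rw [← Fintype.sum_prod_type']
    exact (Fintype.sum_equiv (Fin.consEquiv fun _ => ι) _ _ fun _ => rfl).symm
  rw [h]
  simp only [Fin.prod_univ_succ, Fin.cons_zero, Fin.cons_succ, sampleAvg, Finset.mul_sum,
    mul_assoc]

lemma sampleAvg_sum_apply (hv : ∑ i, v i = 1) (m : ℕ) (g : ι → ℝ) :
    sampleAvg v (fun a : Fin m → ι => ∑ k, g (a k)) = m * ∑ i, v i * g i := by
  induction m with
  | zero => simp [sampleAvg]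
  | succ m ih =>
    rw [sampleAvg_succ]
    simp only [Fin.sum_univ_succ, Fin.cons_zero, Fin.cons_succ, sampleAvg_add, ih,
      sampleAvg_const hv, mul_add, Finset.sum_add_distrib, ← Finset.sum_mul, hv]
    push_cast
    ring

lemma sampleAvg_sum_apply_sq (hv : ∑ i, v i = 1) (m : ℕ) (g : ι → ℝ) :
    sampleAvg v (fun a : Fin m → ι => (∑ k, g (a k)) ^ 2) =
      m * ∑ i, v i * g i ^ 2 + m * (m - 1) * (∑ i, v i * g i) ^ 2 := by
  induction m with
  | zero => simp [sampleAvg]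
  | succ m ih =>
    rw [sampleAvg_succ]
    have h : ∀ i, sampleAvg v (fun a : Fin m → ι =>
        (∑ k, g ((Fin.cons i a : Fin (m + 1) → ι) k)) ^ 2) =
        g i ^ 2 + 2 * g i * (m * ∑ i, v i * g i) +
          (m * ∑ i, v i * g i ^ 2 + m * (m - 1) * (∑ i, v i * g i) ^ 2) := by
      intro i
      rw [← ih, ← sampleAvg_sum_apply hv, ← sampleAvg_const_mul,
        ← sampleAvg_const hv (m := m) (g i ^ 2), ← sampleAvg_add, ← sampleAvg_add]
      congr 1
      funext a
      simp only [Fin.sum_univ_succ, Fin.cons_zero, Fin.cons_succ]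
      ring
    simp only [h, mul_add, Finset.sum_add_distrib, ← Finset.sum_mul, hv]
    have h2 : ∀ r : ℝ, ∑ i, v i * (2 * g i * r) = 2 * r * ∑ i, v i * g i := by
      intro r
      rw [Finset.mul_sum]
      exact Finset.sum_congr rfl fun i _ => by ring
    rw [h2]
    push_cast
    ring

/-- The second moment of the empirical mean. -/
lemma sampleAvg_mean_sq_le (hv : ∑ i, v i = 1) {m : ℕ} (hm : 0 < m) (g : ι → ℝ) :
    sampleAvg v (fun a : Fin m → ι => ((∑ k, g (a k)) / m) ^ 2) ≤
      (∑ i, v i * g i ^ 2) / m + (∑ i, v i * g i) ^ 2 := by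
  have hm' : (0 : ℝ) < m := by exact_mod_cast hm
  have h : sampleAvg v (fun a : Fin m → ι => ((∑ k, g (a k)) / m) ^ 2) =
      (1 / (m : ℝ) ^ 2) * (m * ∑ i, v i * g i ^ 2 + m * (m - 1) * (∑ i, v i * g i) ^ 2) := by
    rw [← sampleAvg_sum_apply_sq hv, ← sampleAvg_const_mul]
    congr 1
    funext a
    ring
  have h2 : (1 / (m : ℝ) ^ 2) *
      (m * ∑ i, v i * g i ^ 2 + m * (m - 1) * (∑ i, v i * g i) ^ 2) =
      (∑ i, v i * g i ^ 2) / m + (∑ i, v i * g i) ^ 2 - (∑ i, v i * g i) ^ 2 / m := by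
    field_simp
    ring
  rw [h, h2]
  have : 0 ≤ (∑ i, v i * g i) ^ 2 / m := by positivity
  linarith

lemma sampleAvg_mean (hv : ∑ i, v i = 1) {m : ℕ} (hm : 0 < m) (g : ι → ℝ) :
    sampleAvg v (fun a : Fin m → ι => (∑ k, g (a k)) / m) = ∑ i, v i * g i := by
  have hm' : (m : ℝ) ≠ 0 := by exact_mod_cast hm.ne'
  simp only [div_eq_inv_mul, sampleAvg_const_mul, sampleAvg_sum_apply hv]
  field_simp

/-- The mean of `f` over the grid of two sequences of samples. -/
noncomputable def gridMean {m : ℕ} (f : ι → ι → ℝ) (a a' : Fin m → ι) : ℝ :=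
  (∑ k, (∑ l, f (a k) (a' l)) / m) / m

lemma sampleAvg_gridMean (hv : ∑ i, v i = 1) {m : ℕ} (hm : 0 < m) (f : ι → ι → ℝ) :
    sampleAvg v (fun a' : Fin m → ι => sampleAvg v fun a => gridMean f a a') =
      ∑ i, ∑ j, v i * v j * f i j := by
  have h : ∀ a' : Fin m → ι, sampleAvg v (fun a => gridMean f a a') =
      ∑ i, v i * ((∑ l, f i (a' l)) / m) := fun a' =>
    sampleAvg_mean hv hm fun i => (∑ l, f i (a' l)) / m
  simp only [h, sampleAvg_sum, sampleAvg_const_mul, sampleAvg_mean hv hm, Finset.mul_sum,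
    mul_assoc]

/-- The second moment of the mean over the grid of two sequences of samples. -/
lemma sampleAvg_gridMean_sq_le (hv0 : ∀ i, 0 ≤ v i) (hv : ∑ i, v i = 1) {m : ℕ} (hm : 0 < m)
    (f : ι → ι → ℝ) :
    sampleAvg v (fun a' : Fin m → ι => sampleAvg v fun a => gridMean f a a' ^ 2) ≤
      (∑ i, ∑ j, v i * v j * f i j ^ 2) / (m : ℝ) ^ 2 + (∑ i, v i * (∑ j, v j * f i j) ^ 2) / m +
        (∑ j, v j * (∑ i, v i * f i j) ^ 2) / m + (∑ i, ∑ j, v i * v j * f i j) ^ 2 := by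
  -- With `a'` fixed, the grid mean is an empirical mean over `a` of the row means, so the
  -- one-sequence bound applies; it is then applied again over `a'`.
  have h1 : ∀ a' : Fin m → ι, sampleAvg v (fun a => gridMean f a a' ^ 2) ≤
      (1 / m) * (∑ i, v i * ((∑ l, f i (a' l)) / m) ^ 2) +
        ((∑ l, ∑ i, v i * f i (a' l)) / m) ^ 2 := by
    intro a'
    refine (sampleAvg_mean_sq_le hv hm fun i => (∑ l, f i (a' l)) / m).trans (le_of_eq ?_)
    have : ∑ i, v i * ((∑ l, f i (a' l)) / m) = (∑ l, ∑ i, v i * f i (a' l)) / m := by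
      rw [Finset.sum_comm, Finset.sum_div]
      refine Finset.sum_congr rfl fun i _ => ?_
      rw [← Finset.mul_sum, mul_div_assoc]
    rw [this]
    ring
  refine (sampleAvg_mono hv0 h1).trans ?_
  rw [sampleAvg_add, sampleAvg_const_mul, sampleAvg_sum]
  simp only [sampleAvg_const_mul]
  have hm' : (0 : ℝ) < m := by exact_mod_cast hm
  have h2 : ∑ i, v i * sampleAvg v (fun a' : Fin m → ι => ((∑ l, f i (a' l)) / m) ^ 2) ≤
      (∑ i, ∑ j, v i * v j * f i j ^ 2) / m + ∑ i, v i * (∑ j, v j * f i j) ^ 2 := by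
    rw [Finset.sum_div, ← Finset.sum_add_distrib]
    refine Finset.sum_le_sum fun i _ => ?_
    refine (mul_le_mul_of_nonneg_left (sampleAvg_mean_sq_le hv hm (f i)) (hv0 i)).trans
      (le_of_eq ?_)
    simp only [mul_assoc, ← Finset.mul_sum]
    ring
  have h3 := sampleAvg_mean_sq_le hv hm fun j => ∑ i, v i * f i j
  have h4 : ∑ j, v j * ∑ i, v i * f i j = ∑ i, ∑ j, v i * v j * f i j := by
    simp only [Finset.mul_sum]
    rw [Finset.sum_comm]
    exact Finset.sum_congr rfl fun i _ => Finset.sum_congr rfl fun j _ => by ring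
  rw [h4] at h3
  have h5 := mul_le_mul_of_nonneg_left h2 (by positivity : (0 : ℝ) ≤ 1 / m)
  refine (add_le_add h5 h3).trans (le_of_eq ?_)
  ring

lemma sampleAvg_gridMean_sub_sq_le (hv0 : ∀ i, 0 ≤ v i) (hv : ∑ i, v i = 1) {m : ℕ} (hm : 0 < m)
    (f : ι → ι → ℝ) :
    sampleAvg v (fun a' : Fin m → ι => sampleAvg v fun a =>
        (gridMean f a a' - ∑ i, ∑ j, v i * v j * f i j) ^ 2) ≤
      (∑ i, ∑ j, v i * v j * f i j ^ 2) / (m : ℝ) ^ 2 + (∑ i, v i * (∑ j, v j * f i j) ^ 2) / m +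
        (∑ j, v j * (∑ i, v i * f i j) ^ 2) / m := by
  have h1 := sampleAvg_gridMean hv hm f
  have h2 := sampleAvg_gridMean_sq_le hv0 hv hm f
  set μ := ∑ i, ∑ j, v i * v j * f i j
  have h3 : ∀ a a' : Fin m → ι, (gridMean f a a' - μ) ^ 2 =
      gridMean f a a' ^ 2 + ((-2 * μ) * gridMean f a a' + μ ^ 2) := fun a a' => by ring
  simp only [h3, sampleAvg_add, sampleAvg_const_mul, sampleAvg_const hv, h1]
  nlinarith

end Sampling

/-! ### From variance bounds to randomized algorithms. -/

/-- Chebyshev's inequality for a finite probability space. -/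
lemma one_sub_le_sum_weights {Ω : Type*} [Fintype Ω] {w Z : Ω → ℝ} {μ ε δ : ℝ}
    (hw0 : ∀ a, 0 ≤ w a) (hw : ∑ a, w a = 1) (hε : 0 < ε)
    (h : ∑ a, w a * (Z a - μ) ^ 2 ≤ δ * ε ^ 2) :
    1 - δ ≤ ∑ a, {a | |Z a - μ| ≤ ε}.indicator w a := by
  have h1 : ∀ a, w a - {a | |Z a - μ| ≤ ε}.indicator w a ≤ w a * (Z a - μ) ^ 2 / ε ^ 2 := by
    intro a
    by_cases ha : |Z a - μ| ≤ ε
    · rw [Set.indicator_of_mem (by exact ha), sub_self]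
      have := hw0 a
      positivity
    · rw [Set.indicator_of_notMem (by exact ha), sub_zero, mul_div_assoc]
      refine le_mul_of_one_le_right (hw0 a) ((one_le_div (by positivity)).2 ?_)
      rw [← sq_abs (Z a - μ)]
      exact pow_le_pow_left₀ hε.le (not_le.1 ha).le 2
  have h2 := Finset.sum_le_sum fun a (_ : a ∈ Finset.univ) => h1 a
  rw [Finset.sum_sub_distrib, hw, ← Finset.sum_div] at h2
  have h3 : (∑ a, w a * (Z a - μ) ^ 2) / ε ^ 2 ≤ δ := (div_le_iff₀ (by positivity)).2 h
  linarith

/-- A finite family of deterministic algorithms with weights gives a randomized algorithm. -/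
lemma exists_randomized_of_weights {N : ℕ} {Ω : Type*} [Fintype Ω] {w : Ω → ℝ}
    (alg : Ω → NonadaptiveQueryAlg N) (hw0 : ∀ a, 0 ≤ w a) (hw : ∑ a, w a = 1)
    {f : SignCube N → ℝ} {q ε δ : ℝ} (hq : ∀ a, ((alg a).queries.card : ℝ) ≤ q) (hε : 0 < ε)
    (h : ∀ x, ∑ a, w a * ((alg a).output x - f x) ^ 2 ≤ δ * ε ^ 2) :
    ∃ R : RandomizedQueryAlg N, RandomizedQueryAlg.MakesAtMost R q ∧
      RandomizedQueryAlg.Estimates R f ε δ := by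
  let P : PMF Ω := PMF.ofFintype (fun a => ENNReal.ofReal (w a)) (by
    rw [← ENNReal.ofReal_sum_of_nonneg fun a _ => hw0 a, hw, ENNReal.ofReal_one])
  refine ⟨P.map alg, fun B hB => ?_, fun x => ?_⟩
  · obtain ⟨a, -, rfl⟩ := (PMF.mem_support_map_iff _ _ _).1 hB
    exact hq a
  · rw [PMF.toOuterMeasure_map_apply, PMF.toOuterMeasure_apply_fintype]
    refine (ENNReal.ofReal_le_ofReal (one_sub_le_sum_weights hw0 hw hε (h x))).trans
      (le_of_eq ?_)
    rw [ENNReal.ofReal_sum_of_nonneg fun a _ => Set.indicator_nonneg (fun a _ => hw0 a) a]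
    refine Finset.sum_congr rfl fun a _ => ?_
    by_cases ha : |(alg a).output x - f x| ≤ ε
    · rw [Set.indicator_of_mem (by exact ha), Set.indicator_of_mem (by exact ha)]
      rfl
    · rw [Set.indicator_of_notMem (by exact ha), Set.indicator_of_notMem (by exact ha),
        ENNReal.ofReal_zero]

/-- A deterministic algorithm that computes `f` up to `ε`, as a randomized one. -/
lemma exists_randomized_of_deterministic {N : ℕ} (B : NonadaptiveQueryAlg N)
    {f : SignCube N → ℝ} {q ε δ : ℝ} (hδ : 0 ≤ δ) (hq : (B.queries.card : ℝ) ≤ q)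
    (h : ∀ x, |B.output x - f x| ≤ ε) :
    ∃ R : RandomizedQueryAlg N, RandomizedQueryAlg.MakesAtMost R q ∧
      RandomizedQueryAlg.Estimates R f ε δ := by
  refine ⟨PMF.pure B, fun B' hB' => ?_, fun x => ?_⟩
  · rw [PMF.mem_support_pure_iff] at hB'
    rwa [hB']
  · rw [PMF.toOuterMeasure_pure_apply, if_pos (by exact h x)]
    exact ENNReal.ofReal_le_one.2 (by linarith)

/-! ### The grid estimator and its variance. -/

section Estimator

variable {N : ℕ} (c : ℝ) (b : Fin N → ℝ) (A : Fin N → Fin N → ℝ) (v : Fin N → ℝ)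

/-- The importance-weighted estimate of `∑ b i x i + ∑ A i j x i x j` from one pair of
coordinates. -/
noncomputable def pairEstimate (x : Fin N → ℝ) (i j : Fin N) : ℝ :=
  A i j * x i * x j / (v i * v j) + b i * x i / v i

/-- The algorithm that queries two sequences of coordinates and averages the estimates from all
pairs. -/
noncomputable def gridAlg {m : ℕ} (a a' : Fin m → Fin N) : NonadaptiveQueryAlg N where
  queries := Finset.univ.image a ∪ Finset.univ.image a'
  decode y := c + gridMean (pairEstimate b A v fun i =>
    -- The default `0` is never used: the grid mean only evaluates at sampled coordinates.
    if h : i ∈ Finset.univ.image a ∪ Finset.univ.image a' then ((y ⟨i, h⟩ : ℤ) : ℝ) else 0) a a'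

lemma gridAlg_output {m : ℕ} (a a' : Fin m → Fin N) (x : SignCube N) :
    (gridAlg c b A v a a').output x = c + gridMean (pairEstimate b A v (signVal x)) a a' := by
  simp [NonadaptiveQueryAlg.output, gridAlg, gridMean, pairEstimate, signVal]

lemma card_queries_gridAlg_le {m : ℕ} (a a' : Fin m → Fin N) :
    (gridAlg c b A v a a').queries.card ≤ 2 * m := by
  have h : ∀ a : Fin m → Fin N, (Finset.univ.image a).card ≤ m := fun a =>
    Finset.card_image_le.trans (by simp)
  refine (Finset.card_union_le _ _).trans ?_
  linarith [h a, h a']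

variable {c b A v}

lemma sum_pairEstimate (hv0 : ∀ i, 0 < v i) (hv : ∑ i, v i = 1) (x : Fin N → ℝ) :
    ∑ i, ∑ j, v i * v j * pairEstimate b A v x i j =
      ∑ i, b i * x i + ∑ i, ∑ j, A i j * x i * x j := by
  have h : ∀ i j, v i * v j * pairEstimate b A v x i j = v j * (b i * x i) + A i j * x i * x j := by
    intro i j
    have := (hv0 i).ne'
    have := (hv0 j).ne'
    unfold pairEstimate
    field_simp
    ring
  simp only [h, Finset.sum_add_distrib, ← Finset.sum_mul, hv, one_mul]

lemma add_sq_le_two_mul (r s : ℝ) : (r + s) ^ 2 ≤ 2 * (r ^ 2 + s ^ 2) := by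
  nlinarith [sq_nonneg (r - s)]

lemma sum_pairEstimate_sq_le (hv0 : ∀ i, 0 < v i) (hv : ∑ i, v i = 1) (x : SignCube N) :
    ∑ i, ∑ j, v i * v j * pairEstimate b A v (signVal x) i j ^ 2 ≤
      2 * (∑ i, ∑ j, A i j ^ 2 / (v i * v j) + ∑ i, b i ^ 2 / v i) := by
  calc _ ≤ ∑ i, ∑ j, 2 * (A i j ^ 2 / (v i * v j) + v j * (b i ^ 2 / v i)) := by
        refine Finset.sum_le_sum fun i _ => Finset.sum_le_sum fun j _ => ?_
        have hi := hv0 i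
        have hj := hv0 j
        refine (mul_le_mul_of_nonneg_left (add_sq_le_two_mul _ _) (by positivity)).trans
          (le_of_eq ?_)
        simp only [div_pow, mul_pow, signVal_sq]
        field_simp
    _ = _ := by
        simp only [← Finset.mul_sum, Finset.sum_add_distrib, ← Finset.sum_mul, hv, one_mul]

lemma sum_row_pairEstimate_sq_le (hv0 : ∀ i, 0 < v i) (hv : ∑ i, v i = 1) (x : SignCube N) :
    ∑ i, v i * (∑ j, v j * pairEstimate b A v (signVal x) i j) ^ 2 ≤
      2 * (∑ i, (∑ j, A i j * signVal x j) ^ 2 / v i + ∑ i, b i ^ 2 / v i) := by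
  rw [← Finset.sum_add_distrib, Finset.mul_sum]
  refine Finset.sum_le_sum fun i _ => ?_
  have hi := hv0 i
  have h : ∑ j, v j * pairEstimate b A v (signVal x) i j =
      signVal x i / v i * (∑ j, A i j * signVal x j + b i) := by
    have h1 : ∀ j, v j * pairEstimate b A v (signVal x) i j =
        signVal x i / v i * (A i j * signVal x j) + v j * (signVal x i / v i * b i) := by
      intro j
      have := (hv0 j).ne'
      unfold pairEstimate
      field_simp
    simp only [h1, Finset.sum_add_distrib, ← Finset.sum_mul, ← Finset.mul_sum, hv]
    ring
  rw [h, mul_pow, div_pow, signVal_sq]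
  calc v i * (1 / v i ^ 2 * (∑ j, A i j * signVal x j + b i) ^ 2)
      = 1 / v i * (∑ j, A i j * signVal x j + b i) ^ 2 := by field_simp
    _ ≤ 1 / v i * (2 * ((∑ j, A i j * signVal x j) ^ 2 + b i ^ 2)) :=
        mul_le_mul_of_nonneg_left (add_sq_le_two_mul _ _) (by positivity)
    _ = _ := by ring

/-- The linear term depends on the first index only, so averaging over that index leaves `b·x`,
which lies in `[-1, 1]`; symmetry of `A` turns columns into rows. -/
lemma sum_col_pairEstimate_sq_le (hv0 : ∀ i, 0 < v i) (hv : ∑ i, v i = 1)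
    (hs : ∀ i j, A i j = A j i) (hb : ∑ i, |b i| ≤ 1) (x : SignCube N) :
    ∑ j, v j * (∑ i, v i * pairEstimate b A v (signVal x) i j) ^ 2 ≤
      2 * (∑ i, (∑ j, A i j * signVal x j) ^ 2 / v i + 1) := by
  have hβ : (∑ i, b i * signVal x i) ^ 2 ≤ 1 := by
    rw [sq_le_one_iff_abs_le_one]
    refine (Finset.abs_sum_le_sum_abs _ _).trans (le_trans (le_of_eq ?_) hb)
    refine Finset.sum_congr rfl fun i _ => ?_
    rcases signVal_eq_one_or x i with h | h <;> simp [h]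
  rw [← hv, ← Finset.sum_add_distrib, Finset.mul_sum]
  refine Finset.sum_le_sum fun j _ => ?_
  have hj := hv0 j
  have h : ∑ i, v i * pairEstimate b A v (signVal x) i j =
      signVal x j / v j * (∑ i, A j i * signVal x i) + ∑ i, b i * signVal x i := by
    rw [Finset.mul_sum, ← Finset.sum_add_distrib]
    refine Finset.sum_congr rfl fun i _ => ?_
    have := (hv0 i).ne'
    rw [hs j i]
    unfold pairEstimate
    field_simp
  rw [h]
  calc _ ≤ v j * (2 * ((signVal x j / v j * (∑ i, A j i * signVal x i)) ^ 2 +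
          (∑ i, b i * signVal x i) ^ 2)) :=
        mul_le_mul_of_nonneg_left (add_sq_le_two_mul _ _) hj.le
    _ = 2 * ((∑ i, A j i * signVal x i) ^ 2 / v j + v j * (∑ i, b i * signVal x i) ^ 2) := by
        rw [mul_pow, div_pow, signVal_sq]
        field_simp
    _ ≤ _ := by
        gcongr
        exact mul_le_of_le_one_right hj.le hβ

/-- The quadratic form is estimated by sampling, up to an explicit variance. -/
lemma exists_randomized_quadratic (hN : 0 < N) (hs : ∀ i j, A i j = A j i)
    (hA : ∀ x y : SignCube N, ∑ i, ∑ j, A i j * signVal x i * signVal y j ≤ 2)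
    (hb : ∑ i, |b i| ≤ 1) {f : SignCube N → ℝ}
    (hf : ∀ x, f x = c + ∑ i, b i * signVal x i + ∑ i, ∑ j, A i j * signVal x i * signVal x j)
    {m : ℕ} (hm : 0 < m) {ε δ : ℝ} (hε : 0 < ε)
    (hvar : 5880 * N / (m : ℝ) ^ 2 + 812 / m ≤ δ * ε ^ 2) :
    ∃ R : RandomizedQueryAlg N, RandomizedQueryAlg.MakesAtMost R (2 * m) ∧
      RandomizedQueryAlg.Estimates R f ε δ := by
  obtain ⟨v, hv0, hv, hAx, hbv, hAv⟩ := exists_sampling_weights hN hA hb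
  have hv0' : ∀ i, 0 ≤ v i := fun i => (hv0 i).le
  have hN1 : (1 : ℝ) ≤ N := by exact_mod_cast hN
  refine exists_randomized_of_weights
    (Ω := (Fin m → Fin N) × (Fin m → Fin N))
    (w := fun a => (∏ k, v (a.1 k)) * ∏ k, v (a.2 k))
    -- The components are swapped because the grid moments average over the second sequence on the
    -- outside.
    (fun a => gridAlg c b A v a.2 a.1)
    (fun a => mul_nonneg (Finset.prod_nonneg fun _ _ => hv0' _)
      (Finset.prod_nonneg fun _ _ => hv0' _)) ?_ ?_ hε ?_
  · rw [Fintype.sum_prod_type]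
    simp only [← Finset.mul_sum, sum_prod_weights hv, mul_one]
  · intro a
    exact_mod_cast card_queries_gridAlg_le c b A v a.2 a.1
  · intro x
    have h1 := sampleAvg_gridMean_sub_sq_le hv0' hv hm (pairEstimate b A v (signVal x))
    have h2 := sum_pairEstimate_sq_le (b := b) (A := A) hv0 hv x
    have h3 := sum_row_pairEstimate_sq_le (b := b) (A := A) hv0 hv x
    have h4 := sum_col_pairEstimate_sq_le hv0 hv hs hb x
    rw [sum_pairEstimate hv0 hv] at h1
    have hm' : (0 : ℝ) < m := by exact_mod_cast hm
    calc _ = sampleAvg v (fun a' : Fin m → Fin N => sampleAvg v fun a =>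
          (gridMean (pairEstimate b A v (signVal x)) a a' - (∑ i, b i * signVal x i +
            ∑ i, ∑ j, A i j * signVal x i * signVal x j)) ^ 2) := by
          rw [Fintype.sum_prod_type]
          simp only [sampleAvg, Finset.mul_sum]
          refine Finset.sum_congr rfl fun a' _ => Finset.sum_congr rfl fun a _ => ?_
          rw [gridAlg_output, hf]
          ring
      _ ≤ _ := h1
      -- `2(2925 N + 15) ≤ 5880 N` as `N ≥ 1`, while `420 = 2(195 + 15)` and `392 = 2(195 + 1)`.
      _ ≤ 5880 * N / (m : ℝ) ^ 2 + 420 / m + 392 / m := by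
          gcongr
          · linarith
          · linarith [hAx x]
          · linarith [hAx x]
      _ = 5880 * N / (m : ℝ) ^ 2 + 812 / m := by ring
      _ ≤ _ := hvar

end Estimator

/-! ### Choice of the sample size. -/

theorem mainTheorem9 :
    ∀ δ : ℝ, 0 < δ → ∃ C : ℝ, 0 < C ∧
      ∀ (N : ℕ) (p : MvPolynomial (Fin N) ℝ), p.totalDegree ≤ 2 →
        (∀ x : SignCube N, |cubeEval p x| ≤ 1) →
        ∀ ε : ℝ, 0 < ε →
          ∃ R : RandomizedQueryAlg N,
            RandomizedQueryAlg.MakesAtMost R (C * (Real.sqrt N / ε)) ∧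
              RandomizedQueryAlg.Estimates R (cubeEval p) ε δ := by
  intro δ hδ
  -- Here `6692 = 5880 + 812`, so that `6692 / D ≤ δ`.
  set D : ℝ := 1 + 6692 / δ with hD
  have hD1 : 1 ≤ D := by
    have : 0 ≤ 6692 / δ := by positivity
    linarith
  refine ⟨2 * D + 2, by linarith, fun N p hp hbd ε hε => ?_⟩
  have hq0 : 0 ≤ √N / ε := by positivity
  have hNs : √(N : ℝ) * √N = N := Real.mul_self_sqrt (Nat.cast_nonneg N)
  rcases le_or_gt 1 ε with hε1 | hε1
  · refine exists_randomized_of_deterministic ⟨∅, fun _ => 0⟩ hδ.le ?_ fun x => ?_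
    · rw [Finset.card_empty, Nat.cast_zero]
      exact mul_nonneg (by linarith) hq0
    · rw [NonadaptiveQueryAlg.output, zero_sub, abs_neg]
      exact (hbd x).trans hε1
  -- If `√N ε ≤ 1` then `N ≤ √N / ε`, and all coordinates can be queried. Otherwise `1/m` is at most
  -- `ε² / D`.
  rcases le_or_gt (√N * ε) 1 with hsmall | hbig
  · refine exists_randomized_of_deterministic
      ⟨Finset.univ, fun y => cubeEval p fun i => y ⟨i, Finset.mem_univ i⟩⟩ hδ.le ?_ fun x => ?_
    · have h1 : (N : ℝ) ≤ √N / ε := by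
        rw [le_div_iff₀ hε]
        nlinarith [Real.sqrt_nonneg (N : ℝ)]
      rw [Finset.card_univ, Fintype.card_fin]
      nlinarith
    · simp [NonadaptiveQueryAlg.output, hε.le]
  have hs0 : 0 < √(N : ℝ) := by
    by_contra! h
    nlinarith
  have hN : 0 < N := Nat.cast_pos.1 (Real.sqrt_pos.1 hs0)
  obtain ⟨c, b, A, hsymm, hdiag, hrep⟩ := exists_symm_quadratic_repr p hp
  have hbd' : ∀ x : SignCube N,
      |c + ∑ i, b i * signVal x i + ∑ i, ∑ j, A i j * signVal x i * signVal x j| ≤ 1 :=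
    fun x => hrep x ▸ hbd x
  set t : ℝ := D * (√N / ε) with ht
  have ht0 : 0 < t := by positivity
  have hmt : t ≤ ⌈t⌉₊ := Nat.le_ceil t
  have hm : 0 < ⌈t⌉₊ := Nat.ceil_pos.2 ht0
  have hvar : 5880 * N / (⌈t⌉₊ : ℝ) ^ 2 + 812 / ⌈t⌉₊ ≤ δ * ε ^ 2 := by
    have h1 : 5880 * N / (⌈t⌉₊ : ℝ) ^ 2 ≤ 5880 * (ε ^ 2 / D) := by
      calc 5880 * N / (⌈t⌉₊ : ℝ) ^ 2 ≤ 5880 * N / t ^ 2 := by gcongr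
        _ = 5880 * (ε ^ 2 / D ^ 2) := by
            have h0 : (√(N : ℝ)) ^ 2 = N := by rw [sq, hNs]
            have h00 : (N : ℝ) ≠ 0 := by exact_mod_cast hN.ne'
            rw [ht, mul_pow, div_pow, h0]
            field_simp
        _ ≤ _ := by
            gcongr
            nlinarith
    have h2 : 812 / (⌈t⌉₊ : ℝ) ≤ 812 * (ε ^ 2 / D) := by
      calc 812 / (⌈t⌉₊ : ℝ) ≤ 812 / t := by gcongr
        _ ≤ 812 * (ε ^ 2 / D) := by
            rw [div_eq_mul_one_div]
            refine mul_le_mul_of_nonneg_left ?_ (by norm_num)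
            rw [ht, div_le_div_iff₀ (by positivity) (by positivity)]
            have : ε ^ 2 * (D * (√N / ε)) = D * (√N * ε) := by field_simp
            rw [this]
            nlinarith
    have h3 : 6692 / D ≤ δ := by
      rw [div_le_iff₀ (by linarith), hD, mul_add, mul_div_cancel₀ _ hδ.ne']
      linarith
    calc _ ≤ 5880 * (ε ^ 2 / D) + 812 * (ε ^ 2 / D) := add_le_add h1 h2
      _ = 6692 / D * ε ^ 2 := by ring
      _ ≤ _ := by gcongr
  obtain ⟨R, hR, hE⟩ := exists_randomized_quadratic hN hsymm
    (bilin_le_two hsymm hdiag (abs_even_part_le_one hbd')) (sum_abs_linear_le_one hbd') hrep hm hε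
    hvar
  refine ⟨R, fun B hB => (hR B hB).trans ?_, hE⟩
  -- This absorbs the rounding: `2⌈t⌉ ≤ 2t + 2 ≤ (2D + 2) √N / ε`.
  have h1 : 1 ≤ √N / ε := by
    rw [le_div_iff₀ hε]
    nlinarith
  have h2 := (Nat.ceil_lt_add_one ht0.le).le
  linarith
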